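/- Let $\Lambda$ be a left and right noetherian ring. For a finitely generated left module $X$ over a ring $\Gamma$ (with $\Gamma=\Lambda$ or $\Gamma=\Lambda^{op}$), let $\operatorname{grade}X=\inf\{i\ge 0\mid \operatorname{Ext}^i_\Gamma(X,\Gamma)\ne 0\}$ (with $\inf\emptyset=\infty$) and let $\operatorname{s.grade}X=\inf\{\operatorname{grade}Y\mid Y\subseteq X \text{ a submodule}\}$. The right multiplication on $\Gamma$ makes $\operatorname{Ext}^i_\Gamma(X,\Gamma)$ a left $\Gamma^{op}$-module. For integers $n,k\ge 0$, say that $\Lambda$ is $G_n(k)$ if $\operatorname{s.grade}\operatorname{Ext}^{i+k}_\Lambda(C,\Lambda)\ge i$ for every finitely generated left $\Lambda$-module $C$ and every $1\le i\le n$, and that $\Lambda$ is $g_n(k)$ if $\operatorname{grade}\operatorname{Ext}^{i+k}_\Lambda(C,\Lambda)\ge i$ for all such $C$ and $i$. Say that $\Lambda$ is $G_n(k)^{op}$ (respectively $g_n(k)^{op}$) if the opposite ring $\Lambda^{op}$ is $G_n(k)$ (respectively $g_n(k)$). Theorem 4.1. For every integer $n\ge 0$: (1) $\Lambda$ is $G_n(0)$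 if and only if $\Lambda$ is $G_n(0)^{op}$; (2) $\Lambda$ is $g_n(1)$ if and only if $\Lambda$ is $g_n(1)^{op}$; (3) $\Lambda$ is $g_n(0)$ if and only if $\Lambda$ is $G_n(1)^{op}$. -/

import Mathlib

open CategoryTheory

noncomputable section

namespace AuslanderType

universe u

/-- The group `Ext^i_R(C, R)` of a left `R`-module `C`. -/
abbrev ExtSelf (R : Type u) [Ring R] (C : Type u) [AddCommGroup C] [Module R C] (i : ℕ) : Type u :=
  Abelian.Ext (ModuleCat.of R C) (ModuleCat.of R R) i

/-- Right multiplication by `a`, i.e. `x ↦ x * a.unop`, as an endomorphism of the left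
`R`-module `R`. -/
def rightMul (R : Type u) [Ring R] (a : Rᵐᵒᵖ) : ModuleCat.of R R ⟶ ModuleCat.of R R :=
  ModuleCat.ofHom (Module.toModuleEnd R (S := Rᵐᵒᵖ) R a)

theorem rightMul_apply (R : Type u) [Ring R] (a : Rᵐᵒᵖ) (x : R) :
    (rightMul R a).hom x = x * a.unop := rfl

theorem rightMul_one (R : Type u) [Ring R] : rightMul R 1 = 𝟙 _ := by
  rw [rightMul, map_one]; rfl

theorem rightMul_zero (R : Type u) [Ring R] : rightMul R 0 = 0 := by
  rw [rightMul, map_zero]; rfl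

theorem rightMul_add (R : Type u) [Ring R] (a b : Rᵐᵒᵖ) :
    rightMul R (a + b) = rightMul R a + rightMul R b := by
  rw [rightMul, map_add]; rfl

theorem rightMul_mul (R : Type u) [Ring R] (a b : Rᵐᵒᵖ) :
    rightMul R (a * b) = rightMul R b ≫ rightMul R a := by
  rw [rightMul, map_mul]; rfl

/-- `Ext^i_R(C, R)` is a module over the opposite ring (i.e. a right `R`-module), functorially
induced by the right multiplications on the coefficient module `R`. -/
instance extModule (R : Type u) [Ring R] (C : Type u) [AddCommGroup C] [Module R C] (i : ℕ) :
    Module Rᵐᵒᵖ (ExtSelf R C i) where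
  smul a e := e.comp (Abelian.Ext.mk₀ (rightMul R a)) (add_zero i)
  one_smul e := by
    change e.comp (Abelian.Ext.mk₀ (rightMul R 1)) (add_zero i) = e
    rw [rightMul_one, Abelian.Ext.comp_mk₀_id]
  mul_smul a b e := by
    change e.comp (Abelian.Ext.mk₀ (rightMul R (a * b))) (add_zero i) =
      (e.comp (Abelian.Ext.mk₀ (rightMul R b)) (add_zero i)).comp
        (Abelian.Ext.mk₀ (rightMul R a)) (add_zero i)
    rw [rightMul_mul, ← Abelian.Ext.mk₀_comp_mk₀, Abelian.Ext.comp_assoc_of_third_deg_zero]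
  smul_zero a := Abelian.Ext.zero_comp ..
  smul_add a e f := Abelian.Ext.add_comp ..
  add_smul a b e := by
    change e.comp (Abelian.Ext.mk₀ (rightMul R (a + b))) (add_zero i) =
      e.comp (Abelian.Ext.mk₀ (rightMul R a)) (add_zero i) +
        e.comp (Abelian.Ext.mk₀ (rightMul R b)) (add_zero i)
    rw [rightMul_add, Abelian.Ext.mk₀_add, Abelian.Ext.comp_add]
  zero_smul e := by
    change e.comp (Abelian.Ext.mk₀ (rightMul R 0)) (add_zero i) = 0
    rw [rightMul_zero, Abelian.Ext.mk₀_zero, Abelian.Ext.comp_zero]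

theorem ext_smul_def (R : Type u) [Ring R] (C : Type u) [AddCommGroup C] [Module R C] (i : ℕ)
    (a : Rᵐᵒᵖ) (e : ExtSelf R C i) :
    a • e = e.comp (Abelian.Ext.mk₀ (rightMul R a)) (add_zero i) := rfl

/-- The grade of a left `R`-module `X`: the infimum of all `i ≥ 0` with `Ext^i_R(X, R) ≠ 0`
(it is `⊤` if there is no such `i`). -/
def modGrade (R : Type u) [Ring R] (X : Type u) [AddCommGroup X] [Module R X] : ℕ∞ :=
  ⨅ (i : ℕ) (_ : Nontrivial (ExtSelf R X i)), (i : ℕ∞)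

/-- The strong grade of a left `R`-module `X`: the infimum of the grades of its submodules. -/
def strongGrade (R : Type u) [Ring R] (X : Type u) [AddCommGroup X] [Module R X] : ℕ∞ :=
  ⨅ Y : Submodule R X, modGrade R Y

/-- `R` is `G_n(k)`: for every finitely generated left `R`-module `C` and all `1 ≤ i ≤ n`, the
right `R`-module `Ext^{i+k}_R(C, R)` has strong grade at least `i`. -/
def StrongCond (R : Type u) [Ring R] (n k : ℕ) : Prop :=
  ∀ (C : Type u) [AddCommGroup C] [Module R C] [Module.Finite R C] (i : ℕ), 1 ≤ i → i ≤ n →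
    (i : ℕ∞) ≤ strongGrade Rᵐᵒᵖ (ExtSelf R C (i + k))

/-- `R` is `g_n(k)`: for every finitely generated left `R`-module `C` and all `1 ≤ i ≤ n`, the
right `R`-module `Ext^{i+k}_R(C, R)` has grade at least `i`. -/
def WeakCond (R : Type u) [Ring R] (n k : ℕ) : Prop :=
  ∀ (C : Type u) [AddCommGroup C] [Module R C] [Module.Finite R C] (i : ℕ), 1 ≤ i → i ≤ n →
    (i : ℕ∞) ≤ modGrade Rᵐᵒᵖ (ExtSelf R C (i + k))

end AuslanderType

end

/-! Resolve C by finite free modules P_i. Let T_i (`coker`) be the cokernel of P_{i-1}^* → P_i^*,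
and B_{i+1} (`coboundary`) the image of T_i in P_{i+1}^*. The sequences 0 → Ext^i(C,R) → T_i →
B_{i+1} → 0 and 0 → B_{i+1} → P_{i+1}^* → T_{i+1} → 0 are exact. For i ≥ 1 they link
Ext^j(Ext^i(C,R),R) to Ext^{j+2}(T_{i+1},R), by an injection or an isomorphism once suitable Ext
groups of T_i vanish (`exists_ext_ext_embedding`). Under g_n(1), Ext^j(T_i,R) = 0 for 1 ≤ j < i ≤
n+2 (`subsingleton_ext_coker_of_le_modGrade`). As T_{i+1} is finitely generated over the opposite
ring, the hypothesis there bounds the grade of Ext^j(Ext^i(C,R),R).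

Such a bound lifts grades one step at a time: if X has grade ≥ m and Ext^m(X,R) has grade ≥ m+1,
then X has grade ≥ m+1 (`succ_le_modGrade`). Indeed the dual complex of X then resolves its T_m by
free modules in length m, so Hom(Ext^m(X,R), T_m) = 0, although Ext^m(X,R) embeds in T_m. For a
submodule Z of Ext^i(C,R), the quotient T_i/Z or Ext^i(C,R)/Z takes the place of T_{i+1}. -/

namespace AuslanderType

open Abelian

universe u

/-! ### Functoriality of Ext^i(-, R) with its opposite-module structure -/

section Functoriality

variable {R : Type u} [Ring R]
variable {A B C X Y : Type u} [AddCommGroup A] [Module R A] [AddCommGroup B] [Module R B]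
  [AddCommGroup C] [Module R C] [AddCommGroup X] [Module R X] [AddCommGroup Y] [Module R Y]

theorem le_modGrade_iff {m : ℕ} :
    (m : ℕ∞) ≤ modGrade R X ↔ ∀ j < m, Subsingleton (ExtSelf R X j) := by
  simp only [modGrade, le_iInf_iff, Nat.cast_le]
  refine forall_congr' fun j => ?_
  rw [← not_imp_not, not_le, not_nontrivial_iff_subsingleton]

/-- The map `Ext^i_R(Y, R) → Ext^i_R(X, R)` induced by a linear map `X → Y`. -/
noncomputable def extMap (f : X →ₗ[R] Y) (i : ℕ) : ExtSelf R Y i →ₗ[Rᵐᵒᵖ] ExtSelf R X i where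
  toFun e := (Ext.mk₀ (ModuleCat.ofHom f)).comp e (zero_add i)
  map_add' e e' := Ext.comp_add ..
  map_smul' a e := by
    simp only [ext_smul_def, RingHom.id_apply, Ext.comp_assoc_of_third_deg_zero]

theorem extMap_id (i : ℕ) : extMap (LinearMap.id : X →ₗ[R] X) i = LinearMap.id := by
  ext e
  exact Ext.mk₀_id_comp e

theorem extMap_comp (f : A →ₗ[R] B) (g : B →ₗ[R] C) (i : ℕ) :
    extMap (g ∘ₗ f) i = extMap f i ∘ₗ extMap g i := by
  ext e
  change (Ext.mk₀ (ModuleCat.ofHom f ≫ ModuleCat.ofHom g)).comp e (zero_add i) = _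
  rw [← Ext.mk₀_comp_mk₀, Ext.comp_assoc_of_second_deg_zero]
  rfl

/-- Linearly equivalent modules have linearly equivalent `Ext`. -/
noncomputable def extCongr (e : X ≃ₗ[R] Y) (i : ℕ) : ExtSelf R Y i ≃ₗ[Rᵐᵒᵖ] ExtSelf R X i :=
  LinearEquiv.ofLinearMap (extMap e.toLinearMap i) (extMap e.symm.toLinearMap i)
    (by rw [← extMap_comp, LinearEquiv.symm_comp, extMap_id])
    (by rw [← extMap_comp, LinearEquiv.comp_symm, extMap_id])

theorem modGrade_congr (e : X ≃ₗ[R] Y) : modGrade R X = modGrade R Y := by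
  refine ENat.eq_of_forall_natCast_le_iff fun m => ?_
  simp only [le_modGrade_iff]
  exact forall₂_congr fun j _ => (extCongr e j).symm.toEquiv.subsingleton_congr

/-- `Ext^0_R(X, R)` is the dual of `X`. -/
noncomputable def extZeroEquiv (X : Type u) [AddCommGroup X] [Module R X] :
    ExtSelf R X 0 ≃ₗ[Rᵐᵒᵖ] (X →ₗ[R] R) where
  __ := Ext.addEquiv₀.trans ModuleCat.homAddEquiv
  map_smul' a e := by
    obtain ⟨f, rfl⟩ := Ext.addEquiv₀.symm.surjective e
    ext x
    have : a • (Ext.addEquiv₀.symm f) = Ext.addEquiv₀.symm (f ≫ rightMul R a) := by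
      rw [ext_smul_def]
      exact Ext.mk₀_comp_mk₀ ..
    simp only [this, AddEquiv.toEquiv_eq_coe, Equiv.toFun_as_coe, EquivLike.coe_coe,
      AddEquiv.trans_apply, AddEquiv.apply_symm_apply]
    rfl

theorem extZeroEquiv_extMap (f : X →ₗ[R] Y) (e : ExtSelf R Y 0) :
    extZeroEquiv X (extMap f 0 e) = extZeroEquiv Y e ∘ₗ f := by
  obtain ⟨g, rfl⟩ := Ext.addEquiv₀.symm.surjective e
  have : extMap f 0 (Ext.addEquiv₀.symm g) = Ext.addEquiv₀.symm (ModuleCat.ofHom f ≫ g) :=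
    Ext.mk₀_comp_mk₀ ..
  rw [this]
  change (Ext.addEquiv₀ (Ext.addEquiv₀.symm (ModuleCat.ofHom f ≫ g))).hom =
    (Ext.addEquiv₀ (Ext.addEquiv₀.symm g)).hom ∘ₗ f
  simp only [AddEquiv.apply_symm_apply]
  rfl

theorem subsingleton_extSelf_succ_of_projective [Module.Projective R X] (i : ℕ) :
    Subsingleton (ExtSelf R X (i + 1)) := by
  have : Projective (ModuleCat.of R X) := inferInstance
  exact Ext.subsingleton_of_projective ..

end Functoriality

/-! ### The contravariant long exact sequence -/

section LongExactSequence

variable {R : Type u} [Ring R]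
variable {A B C : Type u} [AddCommGroup A] [Module R A] [AddCommGroup B] [Module R B]
  [AddCommGroup C] [Module R C] {f : A →ₗ[R] B} {g : B →ₗ[R] C}

/-- The short complex of module objects given by an exact pair of linear maps. -/
abbrev exactComplex (h : Function.Exact f g) : ShortComplex (ModuleCat.{u} R) :=
  ShortComplex.mk (ModuleCat.ofHom f) (ModuleCat.ofHom g) (by
    ext x; exact h.apply_apply_eq_zero x)

theorem exactComplex_shortExact (h : Function.Exact f g) (hf : Function.Injective f)
    (hg : Function.Surjective g) : (exactComplex h).ShortExact where
  exact := (ShortComplex.ShortExact.moduleCat_exact_iff_function_exact _).2 h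
  mono_f := (ModuleCat.mono_iff_injective _).2 hf
  epi_g := (ModuleCat.epi_iff_surjective _).2 hg

/-- The connecting map `Ext^i_R(A, R) → Ext^{i+1}_R(C, R)` of a short exact sequence
`0 → A → B → C → 0`. -/
noncomputable def extConn (h : Function.Exact f g) (hf : Function.Injective f)
    (hg : Function.Surjective g) (i : ℕ) : ExtSelf R A i →ₗ[Rᵐᵒᵖ] ExtSelf R C (i + 1) where
  toFun e := (exactComplex_shortExact h hf hg).extClass.comp e (add_comm 1 i)
  map_add' e e' := Ext.comp_add ..
  map_smul' a e := by
    simp only [ext_smul_def, RingHom.id_apply, Ext.comp_assoc_of_third_deg_zero]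

variable (h : Function.Exact f g) (hf : Function.Injective f) (hg : Function.Surjective g)

theorem exact_extMap_extConn (i : ℕ) : Function.Exact (extMap f i) (extConn h hf hg i) :=
  (ShortComplex.ab_exact_iff_function_exact _).1
    (Ext.contravariant_sequence_exact₁' (exactComplex_shortExact h hf hg) (ModuleCat.of R R) i
      (i + 1) (add_comm 1 i))

theorem exact_extConn_extMap (i : ℕ) : Function.Exact (extConn h hf hg i) (extMap g (i + 1)) :=
  (ShortComplex.ab_exact_iff_function_exact _).1
    (Ext.contravariant_sequence_exact₃' (exactComplex_shortExact h hf hg) (ModuleCat.of R R) i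
      (i + 1) (add_comm 1 i))

end LongExactSequence

/-- Composition with isomorphisms in both variables of `Ext`. -/
noncomputable def extIsoCongr {𝒞 : Type*} [Category 𝒞] [Abelian 𝒞] [HasExt 𝒞] {X X' Y Y' : 𝒞}
    (f : X ≅ X') (g : Y ≅ Y') (i : ℕ) : Ext X Y i ≃+ Ext X' Y' i where
  toFun x := (Ext.mk₀ f.inv).comp (x.comp (Ext.mk₀ g.hom) (add_zero i)) (zero_add i)
  invFun x := (Ext.mk₀ f.hom).comp (x.comp (Ext.mk₀ g.inv) (add_zero i)) (zero_add i)
  left_inv x := by simp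
  right_inv x := by simp
  map_add' x y := by simp

/-! ### Invariance under ring isomorphisms -/

section Transfer

variable {R S : Type u} [Ring R] [Ring S] (e : R ≃+* S)
  {X Y : Type u} [AddCommGroup X] [Module R X] [AddCommGroup Y] [Module S Y]

/-- Restriction of scalars along a ring isomorphism is an exact equivalence preserving projectives,
hence bijective on Ext. This is needed because a ring is only isomorphic to its double opposite. -/
theorem exists_ext_addEquiv_of_semilinear (φ : X ≃+ Y) (hφ : ∀ (r : R) (x : X), φ (r • x) = e r • φ x)
    (i : ℕ) : ∃ ψ : ExtSelf R X i ≃+ ExtSelf S Y i,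
      ∀ (a : Rᵐᵒᵖ) (x : ExtSelf R X i), ψ (a • x) = RingEquiv.op e a • ψ x := by
  let F := (ModuleCat.restrictScalarsEquivalenceOfRingEquiv.{u} e).functor
  let hF : F.PreservesProjectiveObjects := inferInstance
  let f : F.obj (ModuleCat.of S Y) ≅ ModuleCat.of R X :=
    (LinearEquiv.toModuleIso (X₁ := X) (X₂ := F.obj (ModuleCat.of S Y))
      { φ with map_smul' := hφ }).symm
  let g : F.obj (ModuleCat.of S S) ≅ ModuleCat.of R R :=
    (LinearEquiv.toModuleIso (X₁ := R) (X₂ := F.obj (ModuleCat.of S S))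
      { e.toAddEquiv with map_smul' := fun a x => e.map_mul a x }).symm
  have hg (a : Rᵐᵒᵖ) : F.map (rightMul S (RingEquiv.op e a)) ≫ g.hom = g.hom ≫ rightMul R a := by
    rw [← Iso.inv_comp_eq, ← Category.assoc, ← Iso.eq_comp_inv]
    ext
    exact (e.map_mul _ _).symm
  let θ : ExtSelf S Y i ≃+ ExtSelf R X i :=
    (AddEquiv.ofBijective _ (F.mapExt_bijective_of_preservesProjectiveObjects
      (ModuleCat.of S Y) (ModuleCat.of S S) i)).trans (extIsoCongr f g i)
  have hθ (a : Rᵐᵒᵖ) (y : ExtSelf S Y i) : θ (RingEquiv.op e a • y) = a • θ y := by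
    change (Ext.mk₀ f.inv).comp (((y.comp (Ext.mk₀ (rightMul S (RingEquiv.op e a)))
      (add_zero i)).mapExactFunctor F).comp (Ext.mk₀ g.hom) (add_zero i)) (zero_add i) =
      ((Ext.mk₀ f.inv).comp ((y.mapExactFunctor F).comp (Ext.mk₀ g.hom) (add_zero i))
        (zero_add i)).comp (Ext.mk₀ (rightMul R a)) (add_zero i)
    rw [Ext.mapExactFunctor_comp, Ext.mapExactFunctor_mk₀, Ext.comp_assoc_of_third_deg_zero,
      Ext.mk₀_comp_mk₀, hg, ← Ext.mk₀_comp_mk₀, Ext.comp_assoc_of_third_deg_zero,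
      Ext.comp_assoc_of_third_deg_zero]
  refine ⟨θ.symm, fun a x => ?_⟩
  rw [AddEquiv.symm_apply_eq, hθ, AddEquiv.apply_symm_apply]

theorem modGrade_eq_of_semilinear (φ : X ≃+ Y) (hφ : ∀ (r : R) (x : X), φ (r • x) = e r • φ x) :
    modGrade R X = modGrade S Y := by
  refine ENat.eq_of_forall_natCast_le_iff fun m => ?_
  simp only [le_modGrade_iff]
  refine forall₂_congr fun j _ => ?_
  obtain ⟨ψ, -⟩ := exists_ext_addEquiv_of_semilinear e φ hφ j
  exact ψ.toEquiv.subsingleton_congr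

theorem strongGrade_eq_of_semilinear (φ : X ≃+ Y) (hφ : ∀ (r : R) (x : X), φ (r • x) = e r • φ x) :
    strongGrade R X = strongGrade S Y := by
  let : RingHomInvPair (e : R →+* S) (e.symm : S →+* R) := RingHomInvPair.of_ringEquiv e
  let : RingHomInvPair (e.symm : S →+* R) (e : R →+* S) := RingHomInvPair.of_ringEquiv e.symm
  let φ' : X ≃ₛₗ[(e : R →+* S)] Y := { φ with map_smul' := hφ }
  refine Equiv.iInf_congr (Submodule.orderIsoMapComap φ').toEquiv fun Z => ?_
  refine (modGrade_eq_of_semilinear e (φ'.submoduleMap Z).toAddEquiv fun r x => ?_).symm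
  exact (φ'.submoduleMap Z).map_smulₛₗ r x

/-- The module over `S` obtained from an `R`-module through a ring isomorphism has the same
`Ext`-modules. -/
theorem exists_ext_addEquiv_compHom (C : Type u) [AddCommGroup C] [Module S C] (i : ℕ) :
    let := Module.compHom C (e : R →+* S)
    ∃ ψ : ExtSelf R C i ≃+ ExtSelf S C i,
      ∀ (a : Rᵐᵒᵖ) (x : ExtSelf R C i), ψ (a • x) = RingEquiv.op e a • ψ x :=
  let := Module.compHom C (e : R →+* S)
  exists_ext_addEquiv_of_semilinear e (AddEquiv.refl C) (fun _ _ => rfl) i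

theorem finite_compHom (C : Type u) [AddCommGroup C] [Module S C] [Module.Finite S C] :
    let := Module.compHom C (e : R →+* S)
    Module.Finite R C := by
  let := Module.compHom C (e : R →+* S)
  obtain ⟨s, hs⟩ := Module.Finite.fg_top (R := S) (M := C)
  refine ⟨s, ?_⟩
  rw [eq_top_iff]
  rintro x -
  have hx : x ∈ Submodule.span S (s : Set C) := hs ▸ Submodule.mem_top
  induction hx using Submodule.span_induction with
  | mem x h => exact Submodule.subset_span h
  | zero => exact zero_mem _
  | add x y _ _ hx hy => exact add_mem hx hy
  | smul a x _ hx =>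
    have := Submodule.smul_mem _ (e.symm a) hx
    rwa [show e.symm a • x = e (e.symm a) • x from rfl, e.apply_symm_apply] at this

include e in
theorem WeakCond.of_ringEquiv {n k : ℕ} (h : WeakCond R n k) : WeakCond S n k := by
  intro C _ _ _ i hi hin
  let := Module.compHom C (e : R →+* S)
  have := finite_compHom e C
  obtain ⟨ψ, hψ⟩ := exists_ext_addEquiv_compHom e C (i + k)
  rw [← modGrade_eq_of_semilinear (RingEquiv.op e) ψ hψ]
  exact h C i hi hin

include e in
theorem StrongCond.of_ringEquiv {n k : ℕ} (h : StrongCond R n k) : StrongCond S n k := by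
  intro C _ _ _ i hi hin
  let := Module.compHom C (e : R →+* S)
  have := finite_compHom e C
  obtain ⟨ψ, hψ⟩ := exists_ext_addEquiv_compHom e C (i + k)
  rw [← strongGrade_eq_of_semilinear (RingEquiv.op e) ψ hψ]
  exact h C i hi hin

end Transfer

/-! ### Duals of finite free modules -/

section Dual

variable {R : Type u} [Ring R] {X Y : Type u} [AddCommGroup X] [Module R X] [AddCommGroup Y]
  [Module R Y]

/-- The transpose of a linear map, as a linear map over the opposite ring. -/
def transpose (f : X →ₗ[R] Y) : (Y →ₗ[R] R) →ₗ[Rᵐᵒᵖ] (X →ₗ[R] R) where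
  toFun φ := φ ∘ₗ f
  map_add' _ _ := rfl
  map_smul' _ _ := rfl

/-- A ring is isomorphic to its opposite as a module over the opposite. -/
def opSelfEquiv (R : Type u) [Ring R] : R ≃ₗ[Rᵐᵒᵖ] Rᵐᵒᵖ where
  __ := MulOpposite.opAddEquiv
  map_smul' _ _ := rfl

/-- The dual of a finite free module is free over the opposite ring. -/
def dualPiEquiv (R : Type u) [Ring R] (n : ℕ) :
    ((Fin n → R) →ₗ[R] R) ≃ₗ[Rᵐᵒᵖ] (Fin n → Rᵐᵒᵖ) :=
  (LinearEquiv.piRing R R (Fin n) Rᵐᵒᵖ).trans (LinearEquiv.piCongrRight fun _ => opSelfEquiv R)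

instance finite_dual_pi (n : ℕ) : Module.Finite Rᵐᵒᵖ ((Fin n → R) →ₗ[R] R) :=
  Module.Finite.equiv (dualPiEquiv R n).symm

instance projective_dual_pi (n : ℕ) : Module.Projective Rᵐᵒᵖ ((Fin n → R) →ₗ[R] R) :=
  Module.Projective.of_equiv (dualPiEquiv R n).symm

/-- The evaluation of functionals at `x`. -/
def dualEval (x : X) : (X →ₗ[R] R) →ₗ[Rᵐᵒᵖ] Rᵐᵒᵖ where
  toFun φ := MulOpposite.op (φ x)
  map_add' _ _ := rfl
  map_smul' _ _ := rfl

/-- Half of the reflexivity of a finite free module: expand a functional in the coordinate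
projections. -/
theorem exists_eq_dualEval {n : ℕ} (φ : ((Fin n → R) →ₗ[R] R) →ₗ[Rᵐᵒᵖ] Rᵐᵒᵖ) :
    ∃ x, φ = dualEval x := by
  refine ⟨fun k => (φ (LinearMap.proj k)).unop, LinearMap.ext fun f => ?_⟩
  have hf : f = ∑ k, MulOpposite.op (f (Pi.single k 1)) • (LinearMap.proj k : (Fin n → R) →ₗ[R] R) := by
    refine LinearMap.pi_ext' fun k => LinearMap.ext_ring ?_
    simp [Pi.single_apply]
  conv_lhs => rw [hf]
  simp only [map_sum, map_smul, smul_eq_mul]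
  rw [← MulOpposite.unop_inj]
  change _ = f fun k => (φ (LinearMap.proj k)).unop
  rw [LinearMap.pi_apply_eq_sum_univ]
  simp only [Finset.unop_sum, MulOpposite.unop_mul, MulOpposite.unop_op, smul_eq_mul]
  refine Finset.sum_congr rfl fun k _ => congrArg _ (congrArg f ?_)
  ext j
  simp [Pi.single_apply, eq_comm]

theorem eq_zero_of_forall_dual {n : ℕ} (x : Fin n → R)
    (h : ∀ f : (Fin n → R) →ₗ[R] R, f x = 0) : x = 0 :=
  funext fun k => h (LinearMap.proj k)

/-- The identity of Y is a finite sum of maps factoring through R, so every class is a sum of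
classes that factor through Ext^i(X, R). -/
theorem subsingleton_ext_of_equiv_pi {n i : ℕ} (e : Y ≃ₗ[R] (Fin n → R))
    [Subsingleton (ExtSelf R X i)] :
    Subsingleton (Ext (ModuleCat.of R X) (ModuleCat.of R Y) i) := by
  refine subsingleton_of_forall_eq 0 fun α => ?_
  have hid : 𝟙 (ModuleCat.of R Y) = ∑ k : Fin n,
      ModuleCat.ofHom (LinearMap.proj k ∘ₗ e.toLinearMap) ≫
        ModuleCat.ofHom (e.symm.toLinearMap ∘ₗ LinearMap.single R (fun _ => R) k) := by
    ext y
    simp only [ModuleCat.hom_id, LinearMap.id_apply, ModuleCat.hom_sum, LinearMap.sum_apply,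
      ModuleCat.hom_comp, ModuleCat.hom_ofHom, LinearMap.comp_apply, LinearEquiv.coe_coe,
      LinearMap.proj_apply, LinearMap.coe_single]
    rw [← map_sum, Finset.univ_sum_single, e.symm_apply_apply]
  rw [← Ext.comp_mk₀_id α, hid, Ext.mk₀_sum, Ext.comp_sum]
  refine Finset.sum_eq_zero fun k _ => ?_
  rw [← Ext.mk₀_comp_mk₀, ← Ext.comp_assoc_of_third_deg_zero,
    Subsingleton.elim (α.comp (Ext.mk₀ _) (add_zero i)) 0, Ext.zero_comp]

end Dual

/-- A resolution of a module by free modules of finite rank. -/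
structure FreeResolution (R : Type u) [Ring R] (C : Type u) [AddCommGroup C] [Module R C] where
  /-- the ranks -/
  rank : ℕ → ℕ
  /-- the differential -/
  d : ∀ i, (Fin (rank (i + 1)) → R) →ₗ[R] (Fin (rank i) → R)
  /-- the augmentation -/
  aug : (Fin (rank 0) → R) →ₗ[R] C
  surjective_aug : Function.Surjective aug
  exact_zero : Function.Exact (d 0) aug
  exact_succ : ∀ i, Function.Exact (d (i + 1)) (d i)

/-! ### Finite free resolutions and their dual complexes -/

namespace FreeResolution

variable {R : Type u} [Ring R] {C : Type u} [AddCommGroup C] [Module R C]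

section Existence

variable [IsNoetherianRing R]

/-- The rank of a finite free cover of a submodule of a finite free module. -/
noncomputable def coverRank {n : ℕ} (K : Submodule R (Fin n → R)) : ℕ :=
  (Module.Finite.exists_fin' R K).choose

/-- A finite free cover of a submodule of a finite free module. -/
noncomputable def cover {n : ℕ} (K : Submodule R (Fin n → R)) : (Fin (coverRank K) → R) →ₗ[R] K :=
  (Module.Finite.exists_fin' R K).choose_spec.choose

theorem surjective_cover {n : ℕ} (K : Submodule R (Fin n → R)) : Function.Surjective (cover K) :=
  (Module.Finite.exists_fin' R K).choose_spec.choose_spec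

/-- The iterated kernels of finite free covers. -/
noncomputable def syzygySeq {n : ℕ} (K : Submodule R (Fin n → R)) :
    ℕ → Σ n : ℕ, Submodule R (Fin n → R)
  | 0 => ⟨n, K⟩
  | i + 1 => ⟨coverRank (syzygySeq K i).2, LinearMap.ker (cover (syzygySeq K i).2)⟩

theorem nonempty [Module.Finite R C] : Nonempty (FreeResolution R C) := by
  obtain ⟨n, f, hf⟩ := Module.Finite.exists_fin' R C
  let s := syzygySeq (LinearMap.ker f)
  have hr (i : ℕ) : LinearMap.range ((s i).2.subtype ∘ₗ cover (s i).2) = (s i).2 := by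
    rw [LinearMap.range_comp, LinearMap.range_eq_top.2 (surjective_cover _), Submodule.map_top,
      Submodule.range_subtype]
  exact ⟨{
    rank := fun i => (s i).1
    d := fun i => (s i).2.subtype ∘ₗ cover (s i).2
    aug := f
    surjective_aug := hf
    exact_zero := LinearMap.exact_iff.2 (hr 0).symm
    exact_succ := fun i => LinearMap.exact_iff.2 <| by
      refine Eq.trans ?_ (hr (i + 1)).symm
      exact LinearMap.ker_comp_of_ker_eq_bot _ (Submodule.ker_subtype _) }⟩

end Existence

variable (P : FreeResolution R C)

/-- The first syzygy, the kernel of the augmentation. -/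
abbrev syzygy : Submodule R (Fin (P.rank 0) → R) := LinearMap.ker P.aug

/-- The differential, as a map onto the first syzygy. -/
def toSyzygy : (Fin (P.rank 1) → R) →ₗ[R] P.syzygy :=
  (P.d 0).codRestrict _ fun x => P.exact_zero.apply_apply_eq_zero x

theorem surjective_toSyzygy : Function.Surjective P.toSyzygy := by
  rintro ⟨x, hx⟩
  obtain ⟨y, hy⟩ := (P.exact_zero x).1 hx
  exact ⟨y, Subtype.ext hy⟩

/-- The resolution of the first syzygy. -/
def shift : FreeResolution R P.syzygy where
  rank i := P.rank (i + 1)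
  d i := P.d (i + 1)
  aug := P.toSyzygy
  surjective_aug := P.surjective_toSyzygy
  exact_zero x := by
    rw [← P.exact_succ 0 x, ← Submodule.coe_eq_zero]
    rfl
  exact_succ i := P.exact_succ (i + 1)

/-- The terms of the dual complex. -/
abbrev dual (i : ℕ) : Type u := (Fin (P.rank i) → R) →ₗ[R] R

/-- The coboundaries of the dual complex. -/
def coboundary : ∀ i, Submodule Rᵐᵒᵖ (P.dual i)
  | 0 => ⊥
  | i + 1 => LinearMap.range (transpose (P.d i))

theorem coboundary_le (i : ℕ) : P.coboundary i ≤ LinearMap.ker (transpose (P.d i)) := by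
  cases i with
  | zero => exact bot_le
  | succ i =>
    rintro _ ⟨f, rfl⟩
    refine LinearMap.ext fun x => ?_
    change f (P.d i (P.d (i + 1) x)) = 0
    rw [(P.exact_succ i).apply_apply_eq_zero, map_zero]

/-- The cokernels of the dual complex. -/
abbrev coker (i : ℕ) : Type u := P.dual i ⧸ P.coboundary i

/-- The map from a cokernel of the dual complex to the next term. -/
def fromCoker (i : ℕ) : P.coker i →ₗ[Rᵐᵒᵖ] P.dual (i + 1) :=
  (P.coboundary i).liftQ (transpose (P.d i)) (P.coboundary_le i)

theorem range_fromCoker (i : ℕ) : LinearMap.range (P.fromCoker i) = P.coboundary (i + 1) :=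
  Submodule.range_liftQ ..

theorem exact_fromCoker_mkQ (i : ℕ) :
    Function.Exact (P.fromCoker i) (P.coboundary (i + 1)).mkQ := by
  rw [LinearMap.exact_iff, Submodule.ker_mkQ, range_fromCoker]

/-- Every functional on `coker (i + 1)` extends to the next term of the dual complex. -/
theorem exists_functional_extension (i : ℕ) (φ : P.coker (i + 1) →ₗ[Rᵐᵒᵖ] Rᵐᵒᵖ) :
    ∃ ψ : P.dual (i + 2) →ₗ[Rᵐᵒᵖ] Rᵐᵒᵖ, φ = ψ ∘ₗ P.fromCoker (i + 1) := by
  obtain ⟨x, hx⟩ := exists_eq_dualEval (φ ∘ₗ (P.coboundary (i + 1)).mkQ)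
  -- φ is evaluation at x and kills coboundaries, so every functional vanishes at d x. Exactness of
  -- the resolution then provides y.
  have hdx : P.d i x = 0 := by
    refine eq_zero_of_forall_dual _ fun f => ?_
    have h1 : (P.coboundary (i + 1)).mkQ (transpose (P.d i) f) = 0 :=
      (Submodule.Quotient.mk_eq_zero _).2 ⟨f, rfl⟩
    have h2 := LinearMap.congr_fun hx (transpose (P.d i) f)
    rw [LinearMap.comp_apply, h1, map_zero] at h2
    exact (MulOpposite.op_injective h2).symm
  obtain ⟨y, rfl⟩ := (P.exact_succ i x).1 hdx
  refine ⟨dualEval y, ?_⟩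
  refine LinearMap.ext fun t => ?_
  obtain ⟨f, rfl⟩ := Submodule.mkQ_surjective _ t
  exact LinearMap.congr_fun hx f

end FreeResolution

/-! ### Dimension shifting -/

section DimensionShift

variable {R : Type u} [Ring R]
variable {A B C : Type u} [AddCommGroup A] [Module R A] [AddCommGroup B] [Module R B]
  [AddCommGroup C] [Module R C] {f : A →ₗ[R] B} {g : B →ₗ[R] C}
  (h : Function.Exact f g) (hf : Function.Injective f) (hg : Function.Surjective g)

theorem injective_extConn (i : ℕ) (h0 : extMap f i = 0) :
    Function.Injective (extConn h hf hg i) := by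
  rw [injective_iff_map_eq_zero]
  intro x hx
  obtain ⟨y, rfl⟩ := (exact_extMap_extConn h hf hg i x).1 hx
  rw [h0, LinearMap.zero_apply]

theorem surjective_extConn (i : ℕ) [Subsingleton (ExtSelf R B (i + 1))] :
    Function.Surjective (extConn h hf hg i) :=
  fun x => (exact_extConn_extMap h hf hg i x).1 (Subsingleton.elim _ _)

theorem extMap_eq_zero (i : ℕ) [Subsingleton (ExtSelf R B i)] : extMap f i = 0 :=
  LinearMap.ext fun x => by rw [Subsingleton.elim x 0, map_zero, map_zero]

/-- Dimension shift along a short exact sequence with projective middle term. -/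
noncomputable def extConnEquiv [Module.Projective R B] (i : ℕ) :
    ExtSelf R A (i + 1) ≃ₗ[Rᵐᵒᵖ] ExtSelf R C (i + 2) :=
  have := subsingleton_extSelf_succ_of_projective (R := R) (X := B)
  LinearEquiv.ofBijective (extConn h hf hg (i + 1))
    ⟨injective_extConn h hf hg _ (extMap_eq_zero _), surjective_extConn h hf hg _⟩

end DimensionShift

theorem exists_comp_eq_of_exact {R W X Y Z : Type*} [Ring R] [AddCommGroup W] [Module R W]
    [AddCommGroup X] [Module R X] [AddCommGroup Y] [Module R Y] [AddCommGroup Z] [Module R Z]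
    {a : W →ₗ[R] X} {g : X →ₗ[R] Y} (h : Function.Exact a g) (hg : Function.Surjective g)
    (f : X →ₗ[R] Z) (hf : f ∘ₗ a = 0) : ∃ k : Y →ₗ[R] Z, k ∘ₗ g = f := by
  have hle : LinearMap.ker g ≤ LinearMap.ker f := by
    intro x hx
    obtain ⟨y, rfl⟩ := (h x).1 hx
    exact LinearMap.congr_fun hf y
  let e := g.quotKerEquivOfSurjective hg
  refine ⟨(LinearMap.ker g).liftQ f hle ∘ₗ e.symm.toLinearMap, LinearMap.ext fun x => ?_⟩
  have he : e.symm (g x) = Submodule.Quotient.mk x := (e.symm_apply_eq).2 rfl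
  exact congrArg ((LinearMap.ker g).liftQ f hle) he

/-! ### Ext inside the cokernels of the dual complex -/

namespace FreeResolution

variable {R : Type u} [Ring R] {C : Type u} [AddCommGroup C] [Module R C]
  (P : FreeResolution R C)

theorem exact_subtype_aug : Function.Exact P.syzygy.subtype P.aug := by
  rw [LinearMap.exact_iff, Submodule.range_subtype]

/-- Dimension shift along the first syzygy. -/
noncomputable def extSyzygyEquiv (i : ℕ) :
    ExtSelf R P.syzygy (i + 1) ≃ₗ[Rᵐᵒᵖ] ExtSelf R C (i + 2) :=
  extConnEquiv P.exact_subtype_aug P.syzygy.subtype_injective P.surjective_aug i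

/-- Functionals on the syzygy, as elements of the first cokernel of the dual complex. -/
def syzygyDualToCoker : (P.syzygy →ₗ[R] R) →ₗ[Rᵐᵒᵖ] P.coker 1 :=
  (P.coboundary 1).mkQ ∘ₗ transpose P.toSyzygy

theorem syzygyDualToCoker_eq_zero_iff (f : P.syzygy →ₗ[R] R) :
    P.syzygyDualToCoker f = 0 ↔ ∃ g : (Fin (P.rank 0) → R) →ₗ[R] R, g ∘ₗ P.syzygy.subtype = f := by
  refine (Submodule.Quotient.mk_eq_zero _).trans (exists_congr fun g => ?_)
  rw [← LinearMap.cancel_right P.surjective_toSyzygy]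
  rfl

theorem exact_syzygyDualToCoker : Function.Exact P.syzygyDualToCoker (P.fromCoker 1) := by
  refine fun t => ⟨fun ht => ?_, ?_⟩
  · obtain ⟨f, rfl⟩ := Submodule.mkQ_surjective _ t
    obtain ⟨k, rfl⟩ := exists_comp_eq_of_exact P.shift.exact_zero P.surjective_toSyzygy f ht
    exact ⟨k, rfl⟩
  · rintro ⟨f, rfl⟩
    refine LinearMap.ext fun x => ?_
    change f (P.toSyzygy (P.d 1 x)) = 0
    exact (congrArg f (P.shift.exact_zero.apply_apply_eq_zero x)).trans f.map_zero

/-- `Ext^i` is the kernel of the map from the `i`-th cokernel of the dual complex. -/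
theorem exists_ext_embedding {C : Type u} [AddCommGroup C] [Module R C] (P : FreeResolution R C)
    (i : ℕ) :
    ∃ ι : ExtSelf R C i →ₗ[Rᵐᵒᵖ] P.coker i,
      Function.Injective ι ∧ Function.Exact ι (P.fromCoker i) := by
  match i with
  | 0 =>
    have hinj : Function.Injective (transpose P.aug) := fun f g h =>
      (LinearMap.cancel_right P.surjective_aug).1 h
    have hmk : Function.Injective (P.coboundary 0).mkQ := by
      rw [← LinearMap.ker_eq_bot, Submodule.ker_mkQ]
      rfl
    refine ⟨(P.coboundary 0).mkQ ∘ₗ transpose P.aug ∘ₗ (extZeroEquiv C).toLinearMap,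
      hmk.comp (hinj.comp (extZeroEquiv C).injective), fun t => ?_⟩
    obtain ⟨f, rfl⟩ := Submodule.mkQ_surjective _ t
    refine ⟨fun hf => ?_, ?_⟩
    · obtain ⟨k, rfl⟩ := exists_comp_eq_of_exact P.exact_zero P.surjective_aug f hf
      exact ⟨(extZeroEquiv C).symm k, by simp [transpose]⟩
    · rintro ⟨e, he⟩
      rw [← he]
      refine LinearMap.ext fun x => ?_
      change extZeroEquiv C e (P.aug (P.d 0 x)) = 0
      rw [P.exact_zero.apply_apply_eq_zero, map_zero]
  | 1 =>
    -- Ext^1(C, R) is the dual of the syzygy modulo the functionals that extend to P_0. Degree 1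
    -- cannot be shifted to degree 0: the shifted complex has zero coboundaries in degree 0, so its
    -- cokernel there is not `P.coker 1`.
    let δ := extConn P.exact_subtype_aug P.syzygy.subtype_injective P.surjective_aug 0 ∘ₗ
      (extZeroEquiv P.syzygy).symm.toLinearMap
    have hδ : Function.Surjective δ := by
      have := subsingleton_extSelf_succ_of_projective (R := R) (X := Fin (P.rank 0) → R)
      have h (x) := (exact_extConn_extMap P.exact_subtype_aug P.syzygy.subtype_injective
        P.surjective_aug 0 x).1 (Subsingleton.elim _ _)
      intro x
      obtain ⟨y, hy⟩ := h x
      exact ⟨extZeroEquiv _ y, by simp [δ, hy]⟩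
    have hker : LinearMap.ker δ = LinearMap.ker P.syzygyDualToCoker := by
      ext f
      rw [LinearMap.mem_ker, LinearMap.mem_ker, syzygyDualToCoker_eq_zero_iff]
      refine (exact_extMap_extConn P.exact_subtype_aug P.syzygy.subtype_injective
        P.surjective_aug 0 _).trans ⟨?_, ?_⟩
      · rintro ⟨g, hg⟩
        refine ⟨extZeroEquiv _ g, ?_⟩
        rw [← extZeroEquiv_extMap, hg]
        exact LinearEquiv.apply_symm_apply _ _
      · rintro ⟨g, rfl⟩
        refine ⟨(extZeroEquiv _).symm g, (extZeroEquiv _).injective ?_⟩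
        rw [extZeroEquiv_extMap, LinearEquiv.apply_symm_apply]
        exact (LinearEquiv.apply_symm_apply _ _).symm
    let e := δ.quotKerEquivOfSurjective hδ
    have he (f) : e.symm (δ f) = Submodule.Quotient.mk f := (e.symm_apply_eq).2 rfl
    refine ⟨(LinearMap.ker δ).liftQ P.syzygyDualToCoker hker.le ∘ₗ e.symm.toLinearMap,
      (LinearMap.ker_eq_bot.1 (Submodule.ker_liftQ_eq_bot _ _ hker.le hker.ge)).comp e.symm.injective,
      fun t => (P.exact_syzygyDualToCoker t).trans ⟨?_, ?_⟩⟩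
    · rintro ⟨f, rfl⟩
      exact ⟨δ f, congrArg _ (he f)⟩
    · rintro ⟨x, rfl⟩
      obtain ⟨f, rfl⟩ := hδ x
      exact ⟨f, (congrArg ((LinearMap.ker δ).liftQ P.syzygyDualToCoker hker.le) (he f)).symm⟩
  | i + 2 =>
    obtain ⟨ι, hι, hex⟩ := exists_ext_embedding P.shift (i + 1)
    refine ⟨ι ∘ₗ (P.extSyzygyEquiv i).symm.toLinearMap,
      hι.comp (P.extSyzygyEquiv i).symm.injective, fun t => (hex t).trans ?_⟩
    exact (P.extSyzygyEquiv i).symm.surjective.exists (p := fun y => ι y = t)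

/-- If the `i`-th `Ext` vanishes, then the `i`-th cokernel of the dual complex embeds. -/
theorem injective_fromCoker (i : ℕ) [Subsingleton (ExtSelf R C i)] :
    Function.Injective (P.fromCoker i) := by
  obtain ⟨ι, -, hex⟩ := P.exists_ext_embedding i
  rw [injective_iff_map_eq_zero]
  intro x hx
  obtain ⟨y, rfl⟩ := (hex x).1 hx
  rw [Subsingleton.elim y 0, map_zero]

/-- For i < m the sequence 0 → T_i → P_{i+1}^* → T_{i+1} → 0 is exact, so Ext^l(N, T_{i+1}) lies
between Ext^l(N, P_{i+1}^*) = 0 and Ext^{l+1}(N, T_i). The sum i + l is constant along the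
induction. -/
theorem subsingleton_ext_coker {N : Type u} [AddCommGroup N] [Module Rᵐᵒᵖ N] {m : ℕ}
    (hC : ∀ j < m, Subsingleton (ExtSelf R C j))
    (hN : ∀ j ≤ m, Subsingleton (ExtSelf Rᵐᵒᵖ N j)) (i l : ℕ) (hil : i + l ≤ m) :
    Subsingleton (Ext (ModuleCat.of Rᵐᵒᵖ N) (ModuleCat.of Rᵐᵒᵖ (P.coker i)) l) := by
  induction i generalizing l with
  | zero =>
    have := hN l (by lia)
    exact subsingleton_ext_of_equiv_pi
      ((Submodule.quotEquivOfEqBot (P.coboundary 0) rfl).trans (dualPiEquiv R _))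
  | succ i ih =>
    have := hC i (by lia)
    have := hN l (by lia)
    have := ih (l + 1) (by lia)
    have : Subsingleton (Ext (ModuleCat.of Rᵐᵒᵖ N) (ModuleCat.of Rᵐᵒᵖ (P.dual (i + 1))) l) :=
      subsingleton_ext_of_equiv_pi (dualPiEquiv R _)
    refine subsingleton_of_forall_eq 0 fun x => ?_
    obtain ⟨y, hy⟩ := Ext.covariant_sequence_exact₃ _
      (exactComplex_shortExact (P.exact_fromCoker_mkQ i) (P.injective_fromCoker i)
        (Submodule.mkQ_surjective _)) x rfl (Subsingleton.elim _ _)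
    rw [← hy, Subsingleton.elim y 0, Ext.zero_comp]

end FreeResolution

/-- If `C` has grade at least `m` and `Ext^m(C, R)` has grade greater than `m`, then
`Ext^m(C, R)` vanishes. -/
theorem subsingleton_ext_of_lt_grade {R : Type u} [Ring R] [IsNoetherianRing R] {C : Type u}
    [AddCommGroup C] [Module R C] [Module.Finite R C] {m : ℕ}
    (hC : (m : ℕ∞) ≤ modGrade R C)
    (hN : ((m + 1 : ℕ) : ℕ∞) ≤ modGrade Rᵐᵒᵖ (ExtSelf R C m)) :
    Subsingleton (ExtSelf R C m) := by
  rw [le_modGrade_iff] at hC hN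
  obtain ⟨P⟩ := FreeResolution.nonempty (R := R) (C := C)
  obtain ⟨ι, hι, -⟩ := P.exists_ext_embedding m
  -- With i = m and l = 0 this says Hom(Ext^m(C, R), T_m) = 0, so the embedding ι is zero.
  have := P.subsingleton_ext_coker hC (fun j hj => hN j (by lia)) m 0 le_rfl
  have h0 : ModuleCat.ofHom ι = 0 := Ext.addEquiv₀.symm.injective (Subsingleton.elim _ _)
  refine ⟨fun x y => hι ?_⟩
  have h (z) : ι z = 0 := congrArg (fun f => f.hom z) h0
  rw [h, h]

/-! ### Grades and strong grades -/

section Grade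

variable {R : Type u} [Ring R] {X Y C : Type u} [AddCommGroup X] [Module R X] [AddCommGroup Y]
  [Module R Y] [AddCommGroup C] [Module R C]

theorem strongGrade_le_of_injective {f : X →ₗ[R] Y} (hf : Function.Injective f) :
    strongGrade R Y ≤ modGrade R X := by
  rw [modGrade_congr (LinearEquiv.ofInjective f hf)]
  exact iInf_le _ (LinearMap.range f)

theorem strongGrade_le_strongGrade_of_injective {f : X →ₗ[R] Y} (hf : Function.Injective f) :
    strongGrade R Y ≤ strongGrade R X :=
  le_iInf fun Z => strongGrade_le_of_injective (f := f ∘ₗ Z.subtype)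
    (hf.comp Z.subtype_injective)

theorem strongGrade_le_modGrade : strongGrade R X ≤ modGrade R X :=
  strongGrade_le_of_injective (f := LinearMap.id) Function.injective_id

/-- The grade of a module of grade at least `m` exceeds `m` if that of its `m`-th `Ext` does. -/
theorem succ_le_modGrade [IsNoetherianRing R] [Module.Finite R C] {m : ℕ}
    (hC : (m : ℕ∞) ≤ modGrade R C)
    (hN : ((m + 1 : ℕ) : ℕ∞) ≤ modGrade Rᵐᵒᵖ (ExtSelf R C m)) :
    ((m + 1 : ℕ) : ℕ∞) ≤ modGrade R C := by
  have := subsingleton_ext_of_lt_grade hC hN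
  rw [le_modGrade_iff] at hC ⊢
  intro j hj
  obtain hj | rfl := (Nat.lt_succ_iff_lt_or_eq.1 hj)
  exacts [hC j hj, this]

theorem finite_extSelf [IsNoetherianRing R] [IsNoetherianRing Rᵐᵒᵖ] [Module.Finite R C] (i : ℕ) :
    Module.Finite Rᵐᵒᵖ (ExtSelf R C i) := by
  obtain ⟨P⟩ := FreeResolution.nonempty (R := R) (C := C)
  obtain ⟨ι, hι, -⟩ := P.exists_ext_embedding i
  exact Module.Finite.of_injective ι hι

end Grade

/-! ### Passing from k to k + 1 by taking syzygies -/

section Conditions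

variable {R : Type u} [Ring R] {n k : ℕ}

theorem StrongCond.weakCond (h : StrongCond R n k) : WeakCond R n k :=
  fun C _ _ _ i hi hin => (h C i hi hin).trans strongGrade_le_modGrade

variable [IsNoetherianRing R]

theorem WeakCond.succ (h : WeakCond R n k) : WeakCond R n (k + 1) := by
  intro C _ _ _ i hi hin
  obtain ⟨P⟩ := FreeResolution.nonempty (R := R) (C := C)
  obtain ⟨i, rfl⟩ := Nat.exists_eq_add_of_le' hi
  obtain ⟨j, hj⟩ : ∃ j, i + 1 + k = j + 1 := ⟨i + k, by lia⟩
  have := h P.syzygy (i + 1) hi hin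
  rw [← add_assoc, hj]
  rw [hj] at this
  rwa [← modGrade_congr (P.extSyzygyEquiv j)]

theorem StrongCond.succ (h : StrongCond R n k) : StrongCond R n (k + 1) := by
  intro C _ _ _ i hi hin
  obtain ⟨P⟩ := FreeResolution.nonempty (R := R) (C := C)
  obtain ⟨i, rfl⟩ := Nat.exists_eq_add_of_le' hi
  obtain ⟨j, hj⟩ : ∃ j, i + 1 + k = j + 1 := ⟨i + k, by lia⟩
  have := h P.syzygy (i + 1) hi hin
  rw [← add_assoc, hj]
  rw [hj] at this
  exact this.trans (strongGrade_le_strongGrade_of_injective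
    (f := (P.extSyzygyEquiv j).symm.toLinearMap) (P.extSyzygyEquiv j).symm.injective)

end Conditions

/-! ### Ext groups of the cokernels of the dual complex -/

namespace FreeResolution

variable {R : Type u} [Ring R] {C : Type u} [AddCommGroup C] [Module R C]
  (P : FreeResolution R C)

/-- The map from a cokernel of the dual complex onto the next coboundaries. -/
def toCoboundary (i : ℕ) : P.coker i →ₗ[Rᵐᵒᵖ] P.coboundary (i + 1) :=
  (P.fromCoker i).codRestrict _ fun x => P.range_fromCoker i ▸ LinearMap.mem_range_self _ x

theorem surjective_toCoboundary (i : ℕ) : Function.Surjective (P.toCoboundary i) := by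
  rintro ⟨x, hx⟩
  rw [← range_fromCoker] at hx
  obtain ⟨y, hy⟩ := hx
  exact ⟨y, Subtype.ext hy⟩

theorem exact_toCoboundary {i : ℕ} {N : Type u} [AddCommGroup N] [Module Rᵐᵒᵖ N]
    {ι : N →ₗ[Rᵐᵒᵖ] P.coker i} (h : Function.Exact ι (P.fromCoker i)) :
    Function.Exact ι (P.toCoboundary i) := by
  intro x
  rw [← h x, ← Submodule.coe_eq_zero]
  rfl

theorem exact_subtype_mkQ (i : ℕ) :
    Function.Exact (P.coboundary i).subtype (P.coboundary i).mkQ := by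
  rw [LinearMap.exact_iff, Submodule.ker_mkQ, Submodule.range_subtype]

/-- Dimension shift from the coboundaries to the cokernels of the dual complex. -/
noncomputable def extCoboundaryEquiv (i j : ℕ) :
    ExtSelf Rᵐᵒᵖ (P.coboundary i) (j + 1) ≃ₗ[Rᵐᵒᵖᵐᵒᵖ] ExtSelf Rᵐᵒᵖ (P.coker i) (j + 2) :=
  extConnEquiv (P.exact_subtype_mkQ i) (P.coboundary i).subtype_injective
    (Submodule.mkQ_surjective _) j

/-- A functional on the cokernel factors through `fromCoker`, hence dies on its kernel. This
replaces, in degree 0, the vanishing of Ext^j of the cokernel, which is available only for j ≥ 1. -/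
theorem extMap_zero_eq_zero {i : ℕ} {N : Type u} [AddCommGroup N] [Module Rᵐᵒᵖ N]
    (g : N →ₗ[Rᵐᵒᵖ] P.coker (i + 1)) (hg : P.fromCoker (i + 1) ∘ₗ g = 0) : extMap g 0 = 0 := by
  refine LinearMap.ext fun e => (extZeroEquiv N).injective ?_
  rw [extZeroEquiv_extMap, LinearMap.zero_apply, map_zero]
  obtain ⟨ψ, hψ⟩ := P.exists_functional_extension i (extZeroEquiv _ e)
  rw [hψ, LinearMap.comp_assoc, hg, LinearMap.comp_zero]

/-- Functionals on B_{i+2}, pulled back to T_{i+1}, extend to P_{i+2}^*. So restriction from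
P_{i+2}^* to B_{i+2} is onto and the surjective connecting map is zero. -/
theorem subsingleton_ext_one_coker (i : ℕ) : Subsingleton (ExtSelf Rᵐᵒᵖ (P.coker (i + 2)) 1) := by
  have := subsingleton_extSelf_succ_of_projective (R := Rᵐᵒᵖ) (X := P.dual (i + 2))
  have hs := surjective_extConn (A := P.coboundary (i + 2)) (B := P.dual (i + 2))
    (C := P.coker (i + 2)) (P.exact_subtype_mkQ (i + 2))
    (P.coboundary (i + 2)).subtype_injective (Submodule.mkQ_surjective _) 0
  refine subsingleton_of_forall_eq 0 fun x => ?_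
  obtain ⟨y, rfl⟩ := hs x
  refine (exact_extMap_extConn _ _ _ 0 y).2 ?_
  obtain ⟨ψ, hψ⟩ := P.exists_functional_extension i (extZeroEquiv _ y ∘ₗ P.toCoboundary (i + 1))
  refine ⟨(extZeroEquiv _).symm ψ, (extZeroEquiv _).injective ?_⟩
  rw [extZeroEquiv_extMap, LinearEquiv.apply_symm_apply]
  exact ((LinearMap.cancel_right (P.surjective_toCoboundary (i + 1))).1 hψ).symm

/-- Induction on i. For j ≥ 2, Ext^j(T_{i+1}) = Ext^{j-1}(B_{i+1}) lies between
Ext^{j-2}(Ext^i(C,R)), zero by the grade bound, and Ext^{j-1}(T_i), zero by induction. -/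
theorem subsingleton_ext_coker_of_le_modGrade {m : ℕ}
    (h : ∀ i, 1 ≤ i → i ≤ m → (i : ℕ∞) ≤ modGrade Rᵐᵒᵖ (ExtSelf R C (i + 1))) {i j : ℕ}
    (hj : 1 ≤ j) (hji : j < i) (hi : i ≤ m + 2) : Subsingleton (ExtSelf Rᵐᵒᵖ (P.coker i) j) := by
  induction i generalizing j with
  | zero => lia
  | succ i ih =>
    match j, i with
    | 0, _ => lia
    | 1, i + 1 => exact P.subsingleton_ext_one_coker i
    | j + 2, i + 2 =>
      obtain ⟨ι, hι, hex⟩ := P.exists_ext_embedding (i + 2)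
      have h1 : Subsingleton (ExtSelf Rᵐᵒᵖ (P.coker (i + 2)) (j + 1)) :=
        ih (by lia) (by lia) (by lia)
      have h2 : Subsingleton (ExtSelf Rᵐᵒᵖ (ExtSelf R C (i + 2)) j) :=
        le_modGrade_iff.1 (h (i + 1) (by lia) (by lia)) j (by lia)
      have h3 := surjective_extConn (A := ExtSelf R C (i + 2)) (B := P.coker (i + 2))
        (C := P.coboundary (i + 3)) (P.exact_toCoboundary hex) hι
        (P.surjective_toCoboundary (i + 2)) j
      have := h3.subsingleton
      exact (P.extCoboundaryEquiv (i + 3) j).symm.injective.subsingleton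

/-- The map `Ext^j(Ext^i(C, R), R) → Ext^{j+2}(coker, R)` obtained from the two short exact
sequences of the dual complex. -/
theorem exists_ext_ext_embedding (i j : ℕ)
    (h : j ≠ 0 → Subsingleton (ExtSelf Rᵐᵒᵖ (P.coker (i + 1)) j)) :
    ∃ κ : ExtSelf Rᵐᵒᵖ (ExtSelf R C (i + 1)) j →ₗ[Rᵐᵒᵖᵐᵒᵖ]
        ExtSelf Rᵐᵒᵖ (P.coker (i + 2)) (j + 2), Function.Injective κ ∧
      (Subsingleton (ExtSelf Rᵐᵒᵖ (P.coker (i + 1)) (j + 1)) → Function.Surjective κ) := by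
  obtain ⟨ι, hι, hex⟩ := P.exists_ext_embedding (i + 1)
  have h0 : extMap ι j = 0 := by
    obtain rfl | hj := eq_or_ne j 0
    · exact P.extMap_zero_eq_zero ι hex.linearMap_comp_eq_zero
    · have := h hj
      exact extMap_eq_zero j
  refine ⟨(P.extCoboundaryEquiv (i + 2) j).toLinearMap ∘ₗ
    extConn (P.exact_toCoboundary hex) hι (P.surjective_toCoboundary (i + 1)) j,
    (P.extCoboundaryEquiv (i + 2) j).injective.comp (injective_extConn _ _ _ j h0), fun _ => ?_⟩
  exact (P.extCoboundaryEquiv (i + 2) j).surjective.comp (surjective_extConn _ _ _ j)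

end FreeResolution

/-! ### The four implications between a ring and its opposite -/

section Symmetry

variable {R : Type u} [Ring R] [IsNoetherianRing R] [IsNoetherianRing Rᵐᵒᵖ] {n : ℕ}

/-- Induction is needed because the vanishing of Ext^j(T_i) rests on the same condition at lower
level. That vanishing gives Ext^m(Ext^{m+2}(C)) ≅ Ext^{m+2}(T_{m+3}), whose grade the hypothesis
bounds. -/
theorem WeakCond.one_of_op (h : WeakCond Rᵐᵒᵖ n 1) : WeakCond R n 1 := by
  suffices ∀ m ≤ n, WeakCond R m 1 from this n le_rfl
  intro m hm
  induction m with
  | zero => exact fun C _ _ _ i hi hi' => absurd hi (by lia)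
  | succ m ih =>
    have ih := ih (by lia)
    intro C _ _ _ i hi hin
    obtain hin | rfl := Nat.le_succ_iff.1 hin
    · exact ih C i hi hin
    obtain ⟨P⟩ := FreeResolution.nonempty (R := R) (C := C)
    have hT {i j : ℕ} := P.subsingleton_ext_coker_of_le_modGrade (ih C) (i := i) (j := j)
    have := finite_extSelf (R := R) (C := C) (m + 1 + 1)
    refine succ_le_modGrade ?_ ?_
    · rw [← modGrade_congr (P.extSyzygyEquiv m)]
      obtain rfl | hm0 := Nat.eq_zero_or_pos m
      · simp
      · exact ih P.syzygy m hm0 le_rfl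
    · obtain ⟨κ, hκ, hκ'⟩ := P.exists_ext_ext_embedding (m + 1) m
        fun hm0 => hT (by lia) (by lia) (by lia)
      have hκ' := hκ' (hT (by lia) (by lia) le_rfl)
      rw [modGrade_congr (LinearEquiv.ofBijective κ ⟨hκ, hκ'⟩)]
      exact h _ (m + 1) (by lia) hm

/-- For Z ⊆ Ext^{m+2}(C) ⊆ T_{m+2}, the vanishing of Ext of T_{m+2} gives Ext^m(Z) ≅
Ext^{m+1}(T_{m+2}/Z), of grade ≥ m+1 by hypothesis. -/
theorem WeakCond.strongCond_of_op (h : WeakCond Rᵐᵒᵖ n 0) : StrongCond R n 1 := by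
  have hw : WeakCond R n 1 := h.succ.one_of_op
  suffices ∀ m ≤ n, ∀ (C : Type u) [AddCommGroup C] [Module R C] [Module.Finite R C],
      (m : ℕ∞) ≤ strongGrade Rᵐᵒᵖ (ExtSelf R C (m + 1)) from
    fun C _ _ _ i _ hin => this i hin C
  intro m hm
  induction m with
  | zero => simp
  | succ m ih =>
    intro C _ _ _
    refine le_iInf fun Z => ?_
    obtain ⟨P⟩ := FreeResolution.nonempty (R := R) (C := C)
    have hT {i j : ℕ} := P.subsingleton_ext_coker_of_le_modGrade (hw C) (i := i) (j := j)
    have := finite_extSelf (R := R) (C := C) (m + 1 + 1)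
    obtain ⟨ι, hι, hex⟩ := P.exists_ext_embedding (m + 1 + 1)
    let g := ι ∘ₗ Z.subtype
    have hg : Function.Injective g := hι.comp Z.subtype_injective
    refine succ_le_modGrade ?_ ?_
    -- Z also embeds in Ext^{m+1} of the syzygy, where the induction hypothesis applies.
    · exact (ih (by lia) P.syzygy).trans (strongGrade_le_of_injective
        (f := (P.extSyzygyEquiv m).symm.toLinearMap ∘ₗ Z.subtype)
        ((P.extSyzygyEquiv m).symm.injective.comp Z.subtype_injective))
    · have h0 : extMap g m = 0 := by
        obtain rfl | hm0 := Nat.eq_zero_or_pos m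
        · refine P.extMap_zero_eq_zero g ?_
          rw [← LinearMap.comp_assoc, hex.linearMap_comp_eq_zero, LinearMap.zero_comp]
        · have := hT (i := m + 2) hm0 (by lia) (by lia)
          exact extMap_eq_zero m
      have := hT (i := m + 2) (j := m + 1) (by lia) (by lia) (by lia)
      have hgq : Function.Exact g (LinearMap.range g).mkQ := LinearMap.exact_map_mkQ_range g
      have hsurj := Submodule.mkQ_surjective (LinearMap.range g)
      rw [modGrade_congr (LinearEquiv.ofBijective _
        ⟨injective_extConn hgq hg hsurj m h0, surjective_extConn hgq hg hsurj m⟩)]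
      exact h _ (m + 1) (by lia) hm

/-- Only injectivity of Ext^m(Ext^{m+1}(C)) → Ext^{m+2}(T_{m+2}) is available here; the strong grade
of the target controls submodules, so this is enough. -/
theorem StrongCond.weakCond_of_op (h : StrongCond Rᵐᵒᵖ n 1) : WeakCond R n 0 := by
  have hw : WeakCond R n 1 := h.weakCond.one_of_op
  intro C _ _ _ i hi hin
  obtain ⟨m, rfl⟩ := Nat.exists_eq_add_of_le' hi
  obtain ⟨P⟩ := FreeResolution.nonempty (R := R) (C := C)
  have := finite_extSelf (R := R) (C := C) (m + 1)
  refine succ_le_modGrade ?_ ?_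
  · obtain rfl | hm0 := Nat.eq_zero_or_pos m
    · simp
    · exact hw C m hm0 (by lia)
  · obtain ⟨κ, hκ, -⟩ := P.exists_ext_ext_embedding m m fun hm0 =>
      P.subsingleton_ext_coker_of_le_modGrade (hw C) (by lia) (by lia) (by lia)
    exact (h _ (m + 1) hi hin).trans (strongGrade_le_of_injective hκ)

/-- The two preceding implications give G_n(1) and g_n(0) on this side. For Z ⊆ X = Ext^{m+1}(C),
the first gives grade Z ≥ m; the second gives Ext^m(X) = 0, so Ext^m(Z) embeds in Ext^{m+1}(X/Z). -/
theorem StrongCond.zero_of_op (h : StrongCond Rᵐᵒᵖ n 0) : StrongCond R n 0 := by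
  have hs : StrongCond R n 1 := h.weakCond.strongCond_of_op
  have hw : WeakCond R n 0 := h.succ.weakCond_of_op
  intro C _ _ _ i hi hin
  obtain ⟨m, rfl⟩ := Nat.exists_eq_add_of_le' hi
  refine le_iInf fun Z => ?_
  have := finite_extSelf (R := R) (C := C) (m + 1)
  refine succ_le_modGrade ?_ ?_
  · obtain rfl | hm0 := Nat.eq_zero_or_pos m
    · simp
    · exact (hs C m hm0 (by lia)).trans (iInf_le _ Z)
  · have := le_modGrade_iff.1 (hw C (m + 1) hi hin) m (by lia)
    have hZ : Function.Exact Z.subtype Z.mkQ := by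
      rw [LinearMap.exact_iff, Submodule.ker_mkQ, Submodule.range_subtype]
    exact (h _ (m + 1) hi hin).trans (strongGrade_le_of_injective
      (injective_extConn hZ Z.subtype_injective Z.mkQ_surjective m (extMap_eq_zero m)))

end Symmetry

end AuslanderType

theorem theorem4p1 {Λ : Type*} [Ring Λ] [IsNoetherianRing Λ] [IsNoetherianRing Λᵐᵒᵖ] (n : ℕ) :
    (AuslanderType.StrongCond Λ n 0 ↔ AuslanderType.StrongCond Λᵐᵒᵖ n 0) ∧
    (AuslanderType.WeakCond Λ n 1 ↔ AuslanderType.WeakCond Λᵐᵒᵖ n 1) ∧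
    (AuslanderType.WeakCond Λ n 0 ↔ AuslanderType.StrongCond Λᵐᵒᵖ n 1) := by
  -- The implications go from Rᵐᵒᵖ to R; for the forward directions R is Λᵐᵒᵖ, so the hypothesis on
  -- Λ is first moved to the double opposite.
  have e : Λ ≃+* Λᵐᵒᵖᵐᵒᵖ := RingEquiv.opOp Λ
  have : IsNoetherianRing Λᵐᵒᵖᵐᵒᵖ := isNoetherianRing_of_ringEquiv Λ e
  exact ⟨⟨fun h => (h.of_ringEquiv e).zero_of_op, fun h => h.zero_of_op⟩,
    ⟨fun h => (h.of_ringEquiv e).one_of_op, fun h => h.one_of_op⟩,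
    ⟨fun h => (h.of_ringEquiv e).strongCond_of_op, fun h => h.weakCond_of_op⟩⟩
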